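/- Let $S$ and $T$ be commutative noetherian local rings with common residue field $k$, with $S\ne k\ne T$ (that is, neither $S$ nor $T$ is a field), and let $R=S\times_kT=\{(s,t)\in S\times T : \pi_S(s)=\pi_T(t)\}$ be the fiber product (pull-back) of the surjections $S\xrightarrow{\pi_S}k\xleftarrow{\pi_T}T$. Let $M$ and $N$ be finitely generated $R$-modules. (1) If $S$ or $T$ has depth $0$ and $\operatorname{Tor}^R_\ell(M,N)=0$ for some $\ell\ge 5$, then $M$ or $N$ is a free $R$-module. (2) If $\operatorname{Tor}^R_\ell(M,N)=\operatorname{Tor}^R_{\ell+1}(M,N)=0$ for some $\ell\ge 5$, then $\operatorname{pd}_RM\le 1$ or $\operatorname{pd}_RN\le 1$. -/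

import Mathlib

universe u v w x

/-- The fiber product (pull-back) `S ×_k T` of two ring homomorphisms `S → k ← T`: the subring of
`S × T` of all pairs `(s, t)` such that `s` and `t` have the same image in `k`. -/
def fiberProduct {S T k : Type*} [CommRing S] [CommRing T] [CommRing k]
    (πS : S →+* k) (πT : T →+* k) : Subring (S × T) :=
  RingHom.eqLocus (πS.comp (RingHom.fst S T)) (πT.comp (RingHom.snd S T))

/-- The depth of a (noetherian) local ring: the supremum of the lengths of the regular sequences
in its maximal ideal. -/
noncomputable def localRingDepth (A : Type*) [CommRing A] [IsLocalRing A] : ℕ∞ :=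
  sSup {n : ℕ∞ | ∃ rs : List A, (∀ r ∈ rs, r ∈ IsLocalRing.maximalIdeal A) ∧
    RingTheory.Sequence.IsRegular A rs ∧ (rs.length : ℕ∞) = n}

/-- `Tor_n^R(M, N) = 0`. -/
def TorVanishes {R : Type u} [CommRing R] (M N : ModuleCat.{u} R) (n : ℕ) : Prop :=
  CategoryTheory.Limits.IsZero
    (((CategoryTheory.Tor (ModuleCat.{u} R) n).obj M).obj N)

/-! The maximal ideal of `R` is `I ⊕ J`, with `I` and `J` copies of the maximal ideals of `S` and
`T`, so `I * J = 0`. A minimal syzygy that is the kernel of a map of free modules (a second or later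
one) splits as `K = K_I ⊕ K_J` along this sum (`splitBy_ker`).

Let `P`, `Q` be such syzygies of `M`, `N`, with next syzygies `K`, `L`. If `Tor₁(P, Q) = 0`, then `K
⊗ Q` embeds in `F ⊗ Q` with `F` free; but `K_I ⊗ Q_J` goes to zero there, so `K_I = 0` or `Q_J = 0`.
The same holds with `I`, `J` or the modules exchanged. For nonzero `P`, `Q` this leaves `P` inside
`I`, `Q` inside `J`, `K_I = 0`, `L_J = 0`, or the mirror image (`syzygy_alternative`).

A socle element in `I` or `J` contradicts this, by `eq_zero_of_smul_eq_zero`. Without one, the next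
Tor gives a second alternative, incompatible with the first unless `L = 0`. Finally, a nonzero free
module never splits (`SplitBy.range_eq_bot`), so a syzygy that vanishes late vanishes already at the
second step. -/

/-- The submodule `Iⁿ` of `Rⁿ` of all vectors with coordinates in `I`. -/
def Ideal.finPow {R : Type*} [CommRing R] (I : Ideal R) (n : ℕ) : Submodule R (Fin n → R) where
  carrier := {x | ∀ i, x i ∈ I}
  zero_mem' _ := I.zero_mem
  add_mem' hx hy i := I.add_mem (hx i) (hy i)
  smul_mem' a _ hx i := I.mul_mem_left a (hx i)

/-- A submodule `K` of `Rⁿ` is split by the ideals `I` and `J` if it is the sum of its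
intersections with `Iⁿ` and `Jⁿ`. -/
def SplitBy {R : Type*} [CommRing R] (I J : Ideal R) {n : ℕ} (K : Submodule R (Fin n → R)) : Prop :=
  K ≤ (K ⊓ I.finPow _) ⊔ (K ⊓ J.finPow _)

/-! ### Submodules of free modules split by two ideals -/

section Split

open TensorProduct CategoryTheory

variable {R : Type*} [CommRing R] {I J : Ideal R}

lemma SplitBy.symm {n : ℕ} {K : Submodule R (Fin n → R)} (h : SplitBy I J K) : SplitBy J I K := by
  rw [SplitBy, sup_comm]; exact h

lemma inf_finPow_eq_bot (hIJ : I ⊓ J = ⊥) (n : ℕ) :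
    I.finPow n ⊓ J.finPow _ = ⊥ := by
  rw [eq_bot_iff]
  rintro x ⟨h1, h2⟩
  refine funext fun i => ?_
  have : x i ∈ I ⊓ J := ⟨h1 i, h2 i⟩
  simpa [hIJ] using this

lemma mul_eq_zero_of_mem (hIJ : I ⊓ J = ⊥) {a b : R} (ha : a ∈ I) (hb : b ∈ J) : a * b = 0 := by
  have : a * b ∈ I ⊓ J := ⟨I.mul_mem_right _ ha, J.mul_mem_left _ hb⟩
  simpa [hIJ] using this

lemma smul_eq_zero_of_mem_finPow (hIJ : I ⊓ J = ⊥) {n : ℕ} {a : R} (ha : a ∈ I) {y : Fin n → R}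
    (hy : y ∈ J.finPow n) : a • y = 0 :=
  funext fun i => mul_eq_zero_of_mem hIJ ha (hy i)

lemma exists_add_of_mem_finPow_sup {n : ℕ} {x : Fin n → R} (hx : x ∈ (I ⊔ J).finPow n) :
    ∃ y ∈ I.finPow n, ∃ z ∈ J.finPow n, y + z = x := by
  choose y hy z hz h using fun i => Submodule.mem_sup.1 (hx i)
  exact ⟨y, hy, z, hz, funext h⟩

/-- For `x = y + z` in the kernel, `f y = -f z` has entries in both `I` and `J`, hence is zero. -/
lemma splitBy_ker (hIJ : I ⊓ J = ⊥) {p q : ℕ} (f : (Fin p → R) →ₗ[R] (Fin q → R))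
    (hf : LinearMap.ker f ≤ (I ⊔ J).finPow _) : SplitBy I J (LinearMap.ker f) := by
  intro x hx
  obtain ⟨y, hy, z, hz, rfl⟩ := exists_add_of_mem_finPow_sup (hf hx)
  have hyz : f y + f z = 0 := by simpa using hx
  have hfy : f y ∈ I.finPow q ⊓ J.finPow _ := by
    refine ⟨Ideal.map_pi I y hy f, ?_⟩
    rw [eq_neg_of_add_eq_zero_left hyz]
    exact neg_mem (Ideal.map_pi J z hz f)
  rw [inf_finPow_eq_bot hIJ, Submodule.mem_bot] at hfy
  rw [hfy, zero_add] at hyz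
  exact Submodule.add_mem_sup ⟨hfy, hy⟩ ⟨hyz, hz⟩

lemma SplitBy.le_finPow {n : ℕ} {K : Submodule R (Fin n → R)} (h : SplitBy I J K)
    (hK : K ⊓ I.finPow _ = ⊥) : K ≤ J.finPow _ := by
  rw [SplitBy, hK, bot_sup_eq] at h
  exact h.trans inf_le_right

lemma SplitBy.isCompl (hIJ : I ⊓ J = ⊥) {n : ℕ} {K : Submodule R (Fin n → R)} (h : SplitBy I J K) :
    IsCompl ((I.finPow _).submoduleOf K) ((J.finPow _).submoduleOf K) := by
  constructor
  · rw [disjoint_iff, eq_bot_iff]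
    rintro ⟨x, hx⟩ ⟨h1, h2⟩
    have : x ∈ I.finPow n ⊓ J.finPow _ := ⟨h1, h2⟩
    rw [inf_finPow_eq_bot hIJ, Submodule.mem_bot] at this
    simp [this]
  · rw [codisjoint_iff, eq_top_iff]
    rintro ⟨x, hx⟩ -
    obtain ⟨y, hy, z, hz, rfl⟩ := Submodule.mem_sup.1 (h hx)
    exact Submodule.mem_sup.2 ⟨⟨y, hy.1⟩, hy.2, ⟨z, hz.1⟩, hz.2, rfl⟩

/-- The inclusion of `V ⊗ A` into `K ⊗ Q` is injective when `V` and `A` are direct summands. -/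
lemma map_subtype_injective_of_isCompl {K Q : Type*} [AddCommGroup K] [Module R K]
    [AddCommGroup Q] [Module R Q] {V W : Submodule R K} {A B : Submodule R Q}
    (hV : IsCompl V W) (hA : IsCompl A B) :
    Function.Injective (TensorProduct.map V.subtype A.subtype) := by
  refine Function.LeftInverse.injective
    (g := TensorProduct.map (V.projectionOnto W hV) (A.projectionOnto B hA)) fun z => ?_
  rw [← LinearMap.comp_apply, ← TensorProduct.map_comp]
  convert LinearMap.id_apply (R := R) z
  convert TensorProduct.map_id
  · ext; simp
  · ext; simp

/-- By Nakayama this reduces to vector spaces over the residue field, where nonzero factors have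
nonzero tensor product. -/
lemma subsingleton_or_of_tensorProduct [IsLocalRing R] {V A : Type*} [AddCommGroup V] [Module R V]
    [AddCommGroup A] [Module R A] [Module.Finite R V] [Module.Finite R A]
    (h : Subsingleton (V ⊗[R] A)) : Subsingleton V ∨ Subsingleton A := by
  let k := IsLocalRing.ResidueField R
  rw [← IsLocalRing.subsingleton_tensorProduct (R := R) (M := V),
    ← IsLocalRing.subsingleton_tensorProduct (R := R) (M := A)]
  have h1 : Subsingleton (k ⊗[R] (V ⊗[R] A)) := by
    have := IsLocalRing.subsingleton_tensorProduct (R := R) (M := V ⊗[R] A)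
    exact this.2 h
  have e := TensorProduct.AlgebraTensorModule.distribBaseChange R k V A
  have h2 : Subsingleton ((k ⊗[R] V) ⊗[k] (k ⊗[R] A)) := e.symm.toEquiv.subsingleton
  by_contra! hc
  obtain ⟨_, _⟩ := hc
  exact not_subsingleton ((k ⊗[R] V) ⊗[k] (k ⊗[R] A)) h2

lemma inf_finPow_eq_bot_or_of_rTensor_injective [IsLocalRing R] [IsNoetherianRing R] (hIJ : I ⊓ J = ⊥)
    {a n : ℕ} {K : Submodule R (Fin a → R)} {Q : Submodule R (Fin n → R)}
    (hK : SplitBy I J K) (hQ : SplitBy I J Q)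
    (h : Function.Injective (K.subtype.rTensor Q)) :
    K ⊓ I.finPow _ = ⊥ ∨ Q ⊓ J.finPow _ = ⊥ := by
  set V := (I.finPow _).submoduleOf K with hV
  set A := (J.finPow _).submoduleOf Q with hA
  have hinj : Function.Injective
      (K.subtype.rTensor Q ∘ₗ TensorProduct.map V.subtype A.subtype) :=
    h.comp (map_subtype_injective_of_isCompl (hK.isCompl hIJ) (hQ.symm.isCompl
      (inf_comm I J ▸ hIJ)))
  have hzero : K.subtype.rTensor Q ∘ₗ TensorProduct.map V.subtype A.subtype = 0 := by
    refine TensorProduct.ext' fun v y => ?_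
    simp only [LinearMap.comp_apply, TensorProduct.map_tmul, LinearMap.rTensor_tmul,
      LinearMap.zero_apply]
    change (v.1.1 : Fin a → R) ⊗ₜ[R] y.1 = 0
    -- The coordinates of `v` lie in `I`; moved across the tensor sign they kill `y`, whose entries
    -- lie in `J`.
    rw [pi_eq_sum_univ v.1.1, TensorProduct.sum_tmul]
    refine Finset.sum_eq_zero fun i _ => ?_
    rw [TensorProduct.smul_tmul]
    have : v.1.1 i • y.1 = 0 := Subtype.ext (smul_eq_zero_of_mem_finPow hIJ (v.2 i) y.2)
    rw [this, TensorProduct.tmul_zero]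
  rw [hzero] at hinj
  have hs : Subsingleton (V ⊗[R] A) := ⟨fun s t => hinj rfl⟩
  refine (subsingleton_or_of_tensorProduct (R := R) (V := V) (A := A) hs).imp (fun h => ?_) (fun h => ?_)
  · rw [eq_bot_iff]
    rintro x ⟨hx, hx'⟩
    have := congrArg (fun y : V => (y.1.1 : Fin a → R)) (h.elim ⟨⟨x, hx⟩, hx'⟩ 0)
    simpa using this
  · rw [eq_bot_iff]
    rintro x ⟨hx, hx'⟩
    have := congrArg (fun y : A => (y.1.1 : Fin n → R)) (h.elim ⟨⟨x, hx⟩, hx'⟩ 0)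
    simpa using this

/-- If `x ∈ I` kills `P ≠ 0` and the kernel of a surjection `Rᵃ → P` avoids `Iᵃ`, then `x = 0`. -/
lemma eq_zero_of_smul_eq_zero {a p : ℕ} (g : (Fin a → R) →ₗ[R] (Fin p → R))
    (hg : LinearMap.range g ≠ ⊥)
    (hker : LinearMap.ker g ⊓ I.finPow _ = ⊥) {x : R} (hx : x ∈ I)
    (hxg : ∀ y ∈ LinearMap.range g, x • y = 0) : x = 0 := by
  rcases Nat.eq_zero_or_pos a with rfl | ha
  · exact absurd (by rw [Subsingleton.elim g 0, LinearMap.range_zero]) hg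
  · have hmem : Pi.single (⟨0, ha⟩ : Fin a) x ∈ LinearMap.ker g ⊓ I.finPow _ := by
      refine ⟨?_, fun i => ?_⟩
      swap
      · by_cases hi : i = ⟨0, ha⟩
        · subst hi; simpa using hx
        · simp [Pi.single_eq_of_ne hi]
      have : (Pi.single (⟨0, ha⟩ : Fin a) x : Fin a → R) = x • Pi.single ⟨0, ha⟩ 1 := by
        rw [← Pi.single_smul, smul_eq_mul, mul_one]
      change g _ = 0
      rw [this, map_smul]
      exact hxg _ ⟨_, rfl⟩
    rw [hker, Submodule.mem_bot] at hmem
    simpa using congrFun hmem ⟨0, ha⟩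

/-- A free submodule of `Rⁿ` that is split by `I` and `J` is zero. -/
lemma SplitBy.range_eq_bot [IsLocalRing R] (hIJ : I ⊓ J = ⊥) (hI : I ≠ ⊥) (hJ : J ≠ ⊥) {a p : ℕ}
    (g : (Fin a → R) →ₗ[R] (Fin p → R)) (hg : LinearMap.ker g = ⊥)
    (hs : SplitBy I J (LinearMap.range g)) : LinearMap.range g = ⊥ := by
  rcases Nat.eq_zero_or_pos a with rfl | ha
  · rw [Subsingleton.elim g 0, LinearMap.range_zero]
  exfalso
  obtain ⟨y, ⟨⟨y, rfl⟩, hy⟩, z, ⟨⟨z, rfl⟩, hz⟩, h⟩ :=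
    Submodule.mem_sup.1 (hs ⟨Pi.single (⟨0, ha⟩ : Fin a) 1, rfl⟩)
  have hinj := LinearMap.ker_eq_bot.1 hg
  rw [← map_add] at h
  have h1 : y ⟨0, ha⟩ + z ⟨0, ha⟩ = 1 := by simpa using congrFun (hinj h) ⟨0, ha⟩
  -- If `z` has a unit coordinate, a nonzero `x ∈ I` kills `g z`, hence `z` by injectivity, hence `x
  -- = 0`.
  have key : ∀ {I J : Ideal R} (_ : I ⊓ J = ⊥) (_ : I ≠ ⊥) (z : Fin a → R)
      (_ : g z ∈ J.finPow _), ¬ IsUnit (z ⟨0, ha⟩) := by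
    intro I J hIJ hI z hz hu
    obtain ⟨x, hx, hx0⟩ := Submodule.exists_mem_ne_zero_of_ne_bot hI
    have : x • z = 0 := hinj (by rw [map_smul, smul_eq_zero_of_mem_finPow hIJ hx hz, map_zero])
    have h2 : x * z ⟨0, ha⟩ = 0 := congrFun this ⟨0, ha⟩
    exact hx0 ((hu.mul_left_eq_zero).1 h2)
  rcases IsLocalRing.isUnit_or_isUnit_of_add_one h1 with h | h
  · exact key (inf_comm I J ▸ hIJ) hJ y hy h
  · exact key hIJ hI z hz h

end Split

/-! ### Minimal free resolutions and Tor -/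

section Resolution

open TensorProduct CategoryTheory

/-- A resolution of `N` by finite free modules `Rᵇ⁽ⁿ⁾`. -/
structure FiniteFreeResolution (R : Type u) [CommRing R] (N : Type v) [AddCommGroup N]
    [Module R N] where
  /-- the ranks -/
  b : ℕ → ℕ
  /-- the differentials -/
  d (n : ℕ) : (Fin (b (n + 1)) → R) →ₗ[R] (Fin (b n) → R)
  /-- the augmentation -/
  ε : (Fin (b 0) → R) →ₗ[R] N
  surjective : Function.Surjective ε
  exact_zero : Function.Exact (d 0) ε
  exact (n : ℕ) : Function.Exact (d (n + 1)) (d n)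

/-- A resolution is minimal with respect to the ideal `m` if all its syzygies lie in `m Rᵇ`. -/
structure FiniteFreeResolution.IsMinimal {R : Type u} [CommRing R] {N : Type v} [AddCommGroup N]
    [Module R N] (G : FiniteFreeResolution R N) (m : Ideal R) : Prop where
  ker_ε_le : LinearMap.ker G.ε ≤ m.finPow _
  ker_d_le (n : ℕ) : LinearMap.ker (G.d n) ≤ m.finPow _

variable {R : Type u} [CommRing R]

lemma exists_minimal_cover [IsLocalRing R] (N : Type v) [AddCommGroup N] [Module R N]
    [Module.Finite R N] : ∃ (n : ℕ) (f : (Fin n → R) →ₗ[R] N), Function.Surjective f ∧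
      LinearMap.ker f ≤ (IsLocalRing.maximalIdeal R).finPow n := by
  classical
  have hex : ∃ n, ∃ f : (Fin n → R) →ₗ[R] N, Function.Surjective f :=
    Module.Finite.exists_fin' R N
  obtain ⟨f, hf⟩ := Nat.find_spec hex
  refine ⟨_, f, hf, fun x hx i => ?_⟩
  by_contra hi
  have hu : IsUnit (x i) := by simpa using hi
  obtain ⟨m, hm⟩ : ∃ m, Nat.find hex = m + 1 := Nat.exists_eq_succ_of_ne_zero (by
    have := i.2; lia)
  -- A relation with a unit coordinate makes that generator redundant, against the minimality of the
  -- rank.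
  refine Nat.find_min hex (m := m) (by lia) ?_
  revert f i x
  rw [hm]
  intro f hf x hx i hi hu
  refine ⟨f ∘ₗ
    (LinearMap.pi fun j => if h : ∃ l : Fin m, i.succAbove l = j
      then LinearMap.proj h.choose else 0), ?_⟩
  obtain ⟨u, hu⟩ := hu
  intro y
  obtain ⟨z, rfl⟩ := hf y
  set z' := z - (z i * (↑u⁻¹ : R)) • x with hz'
  have hzi : z' i = 0 := by simp [hz', ← hu]
  have hfz : f z' = f z := by
    have hx' : f x = 0 := hx
    simp [hz', hx']
  refine ⟨fun l => z' (i.succAbove l), ?_⟩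
  rw [← hfz]
  change f _ = _
  congr 1
  funext j
  change (LinearMap.pi _ : (Fin m → R) →ₗ[R] (Fin (m + 1) → R)) _ j = _
  rw [LinearMap.pi_apply]
  split_ifs with h
  · change z' (i.succAbove h.choose) = _
    rw [h.choose_spec]
  · rcases eq_or_ne j i with rfl | hj
    · simp [hzi]
    · exact absurd (Fin.exists_succAbove_eq hj) h

theorem exists_minimal_resolution [IsLocalRing R] [IsNoetherianRing R] (N : Type v)
    [AddCommGroup N] [Module R N] [Module.Finite R N] :
    ∃ G : FiniteFreeResolution R N, G.IsMinimal (IsLocalRing.maximalIdeal R) := by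
  obtain ⟨n₀, ε, hε, hker⟩ := exists_minimal_cover (R := R) N
  -- The recursion carries a rank `n` and the submodule of `Rⁿ` to be covered next.
  have step : ∀ s : Σ n, Submodule R (Fin n → R), ∃ (p : ℕ) (f : (Fin p → R) →ₗ[R] (Fin s.1 → R)),
      LinearMap.range f = s.2 ∧ LinearMap.ker f ≤ (IsLocalRing.maximalIdeal R).finPow p := by
    rintro ⟨n, K⟩
    obtain ⟨p, f, hf, hk⟩ := exists_minimal_cover (R := R) K
    refine ⟨p, K.subtype ∘ₗ f, ?_, ?_⟩
    · rw [LinearMap.range_comp, LinearMap.range_eq_top.2 hf, Submodule.map_top,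
        Submodule.range_subtype]
    · rw [LinearMap.ker_comp_of_ker_eq_bot _ K.ker_subtype]
      exact hk
  choose p f hf hk using step
  let S : ℕ → Σ n, Submodule R (Fin n → R) :=
    fun n => Nat.rec ⟨n₀, LinearMap.ker ε⟩ (fun _ s => ⟨p s, LinearMap.ker (f s)⟩) n
  refine ⟨⟨fun n => (S n).1, fun n => f (S n), ε, hε, ?_, fun n => ?_⟩, hker, fun n => hk (S n)⟩
  · exact LinearMap.exact_iff.2 (hf (S 0)).symm
  · exact LinearMap.exact_iff.2 (hf (S (n + 1))).symm

namespace FiniteFreeResolution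

variable {N : Type u} [AddCommGroup N] [Module R N] (G : FiniteFreeResolution R N)

/-- The chain complex of a finite free resolution. -/
noncomputable def complex : ChainComplex (ModuleCat.{u} R) ℕ :=
  ChainComplex.of (fun n => ModuleCat.of R (Fin (G.b n) → R)) (fun n => ModuleCat.ofHom (G.d n))
    fun n => by
      ext1
      simpa using (G.exact n).linearMap_comp_eq_zero

lemma complex_d (n : ℕ) : G.complex.d (n + 1) n = ModuleCat.ofHom (G.d n) :=
  ChainComplex.of_d (fun n => ModuleCat.of R (Fin (G.b n) → R)) (fun n => ModuleCat.ofHom (G.d n)) n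

/-- A finite free resolution as a projective resolution. -/
noncomputable def toProjectiveResolution : ProjectiveResolution (ModuleCat.of R N) where
  complex := G.complex
  projective n := by
    change Projective (ModuleCat.of R (Fin (G.b n) → R))
    rw [← IsProjective.iff_projective]
    infer_instance
  π := (ChainComplex.toSingle₀Equiv _ _).symm ⟨ModuleCat.ofHom G.ε, by
    rw [complex_d]
    change ModuleCat.ofHom (G.ε ∘ₗ G.d 0) = 0
    rw [G.exact_zero.linearMap_comp_eq_zero]
    rfl⟩
  quasiIso := ⟨fun n => by
    cases n with
    | zero =>
      rw [ChainComplex.quasiIsoAt₀_iff, ShortComplex.quasiIso_iff_of_zeros']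
      · refine (ShortComplex.exact_and_epi_g_iff_of_iso (S₂ := ShortComplex.mk
          (ModuleCat.ofHom (G.d 0)) (ModuleCat.ofHom G.ε) (by
            ext1; simpa using G.exact_zero.linearMap_comp_eq_zero)) ?_).2
          ⟨(ShortComplex.ShortExact.moduleCat_exact_iff_function_exact _).2 G.exact_zero,
            (ModuleCat.epi_iff_surjective _).2 G.surjective⟩
        refine ShortComplex.isoMk (Iso.refl _) (Iso.refl _) (Iso.refl _) ?_ ?_
        · change 𝟙 _ ≫ ModuleCat.ofHom (G.d 0) = G.complex.d 1 0 ≫ 𝟙 _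
          rw [Category.id_comp, Category.comp_id]
          exact (G.complex_d 0).symm
        · change 𝟙 _ ≫ ModuleCat.ofHom G.ε =
            ((G.complex.toSingle₀Equiv (ModuleCat.of R N)).symm ⟨ModuleCat.ofHom G.ε, _⟩).f 0 ≫ 𝟙 _
          rw [Category.id_comp, Category.comp_id]
          rfl
      all_goals rfl
    | succ n =>
      rw [quasiIsoAt_iff_exactAt']
      · rw [HomologicalComplex.exactAt_iff' _ (n + 1 + 1) (n + 1) n (by simp) (by simp),
          ShortComplex.ShortExact.moduleCat_exact_iff_function_exact]
        change Function.Exact (G.complex.d (n + 1 + 1) (n + 1)) (G.complex.d (n + 1) n)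
        rw [complex_d, complex_d]
        exact G.exact n
      · apply ChainComplex.exactAt_succ_single_obj⟩

lemma exact_of_torVanishes (M : Type u) [AddCommGroup M] [Module R M] (n : ℕ)
    (h : TorVanishes (ModuleCat.of R M) (ModuleCat.of R N) (n + 1)) :
    Function.Exact ((G.d (n + 1)).lTensor M) ((G.d n).lTensor M) := by
  have h1 := h.of_iso (G.toProjectiveResolution.isoLeftDerivedObj
    ((MonoidalCategory.tensoringLeft _).obj (ModuleCat.of R M)) (n + 1)).symm
  have h2 := (HomologicalComplex.exactAt_iff_isZero_homology _ _).2 h1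
  rw [HomologicalComplex.exactAt_iff' _ (n + 1 + 1) (n + 1) n (by simp) (by simp),
    ShortComplex.ShortExact.moduleCat_exact_iff_function_exact] at h2
  have e1 : ∀ k, (ModuleCat.Hom.hom (((MonoidalCategory.tensoringLeft (ModuleCat.{u} R)).obj
      (ModuleCat.of R M)).map (G.complex.d (k + 1) k))) = (G.d k).lTensor M := by
    intro k
    rw [complex_d]
    rfl
  rw [← e1 n, ← e1 (n + 1)]
  exact h2

end FiniteFreeResolution
end Resolution

/-! ### Dimension shifting by diagram chases -/

section DimensionShift

open TensorProduct CategoryTheory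

variable {R : Type*} [CommRing R]

lemma LinearMap.rTensor_lTensor_apply {U V Y Z : Type*} [AddCommGroup U] [Module R U]
    [AddCommGroup V] [Module R V] [AddCommGroup Y] [Module R Y] [AddCommGroup Z] [Module R Z]
    (f : U →ₗ[R] V) (g : Y →ₗ[R] Z) (t : U ⊗[R] Y) :
    f.rTensor Z (g.lTensor U t) = g.lTensor V (f.rTensor Y t) := by
  rw [← LinearMap.comp_apply, ← LinearMap.comp_apply, LinearMap.rTensor_comp_lTensor,
    LinearMap.lTensor_comp_rTensor]

lemma LinearMap.codRestrict_ker_surjective {A B C : Type*} [AddCommGroup A] [Module R A]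
    [AddCommGroup B] [Module R B] [AddCommGroup C] [Module R C] {f : A →ₗ[R] B} {g : B →ₗ[R] C}
    (h : Function.Exact f g) :
    Function.Surjective (f.codRestrict (ker g) fun x => LinearMap.mem_ker.2 (h.apply_apply_eq_zero x)) := by
  rintro ⟨y, hy⟩
  obtain ⟨x, rfl⟩ := (h y).1 hy
  exact ⟨x, rfl⟩

lemma LinearMap.exact_subtype_codRestrict {A B : Type*} [AddCommGroup A] [Module R A]
    [AddCommGroup B] [Module R B] (f : A →ₗ[R] B) {P : Submodule R B} (h : ∀ x, f x ∈ P) :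
    Function.Exact (ker f).subtype (f.codRestrict P h) := by
  rw [LinearMap.exact_iff, LinearMap.ker_codRestrict, Submodule.range_subtype]

variable {K F X : Type*} [AddCommGroup K] [Module R K] [AddCommGroup F] [Module R F]
  [AddCommGroup X] [Module R X] {i : K →ₗ[R] F} {p : F →ₗ[R] X}
  {A B C D : Type*} [AddCommGroup A] [Module R A] [AddCommGroup B] [Module R B]
  [AddCommGroup C] [Module R C] [AddCommGroup D] [Module R D]
  {d₃ : A →ₗ[R] B} {d₂ : B →ₗ[R] C} {d₁ : C →ₗ[R] D}

/-- The chase common to both shifts: exactness over `X` allows `w` to be corrected by a boundary so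
that it comes from `K ⊗ B`; flatness of `C` then cancels `i`. -/
lemma exists_lTensor_apply_eq [Module.Flat R C] (hi : Function.Injective i)
    (hip : Function.Exact i p) (hp : Function.Surjective p) (h32 : d₂ ∘ₗ d₃ = 0)
    (hX : Function.Exact (d₃.lTensor X) (d₂.lTensor X)) {z : K ⊗[R] C} {w : F ⊗[R] B}
    (hzw : i.rTensor C z = d₂.lTensor F w) : ∃ v, d₂.lTensor K v = z := by
  have hpi : p.rTensor C (i.rTensor C z) = 0 := by
    rw [← LinearMap.comp_apply, ← LinearMap.rTensor_comp, hip.linearMap_comp_eq_zero]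
    simp
  rw [hzw, LinearMap.rTensor_lTensor_apply] at hpi
  obtain ⟨a, ha⟩ := (hX _).1 hpi
  obtain ⟨a, rfl⟩ := LinearMap.rTensor_surjective A hp a
  have h0 : p.rTensor B (w - d₃.lTensor F a) = 0 := by
    rw [map_sub, ← ha, sub_eq_zero, LinearMap.rTensor_lTensor_apply]
  obtain ⟨v, hv⟩ := (rTensor_exact B hip hp _).1 h0
  refine ⟨v, Module.Flat.rTensor_preserves_injective_linearMap (M := C) i hi ?_⟩
  rw [hzw, LinearMap.rTensor_lTensor_apply, hv, map_sub, ← LinearMap.comp_apply (LinearMap.lTensor F d₂),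
    ← LinearMap.lTensor_comp, h32]
  simp

/-- Replacing `X` by its syzygy `K` lowers the Tor degree by one. -/
lemma lTensor_exact_of_lTensor_exact [Module.Flat R C] [Module.Flat R F]
    (hi : Function.Injective i) (hip : Function.Exact i p) (hp : Function.Surjective p)
    (h32 : d₂ ∘ₗ d₃ = 0) (h21 : Function.Exact d₂ d₁)
    (hX : Function.Exact (d₃.lTensor X) (d₂.lTensor X)) :
    Function.Exact (d₂.lTensor K) (d₁.lTensor K) := by
  intro z
  constructor
  · intro hz
    have h0 : d₁.lTensor F (i.rTensor C z) = 0 := by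
      rw [← LinearMap.rTensor_lTensor_apply, hz, map_zero]
    obtain ⟨w, hw⟩ := (Module.Flat.lTensor_exact F h21 _).1 h0
    exact exists_lTensor_apply_eq hi hip hp h32 hX hw.symm
  · rintro ⟨v, rfl⟩
    rw [← LinearMap.comp_apply, ← LinearMap.lTensor_comp, h21.linearMap_comp_eq_zero]
    simp

/-- The last shift: `D` is the cokernel of `d₂`, and the hypothesis amounts to `Tor₁(X, D) = 0` when
the complex resolves `D`. -/
lemma rTensor_injective_of_lTensor_exact [Module.Flat R C]
    (hi : Function.Injective i) (hip : Function.Exact i p) (hp : Function.Surjective p)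
    (h32 : d₂ ∘ₗ d₃ = 0) (h21 : Function.Exact d₂ d₁) (hd₁ : Function.Surjective d₁)
    (hX : Function.Exact (d₃.lTensor X) (d₂.lTensor X)) :
    Function.Injective (i.rTensor D) := by
  rw [injective_iff_map_eq_zero]
  intro z hz
  obtain ⟨z, rfl⟩ := LinearMap.lTensor_surjective K hd₁ z
  rw [LinearMap.rTensor_lTensor_apply] at hz
  obtain ⟨w, hw⟩ := (lTensor_exact F h21 hd₁ _).1 hz
  obtain ⟨v, rfl⟩ := exists_lTensor_apply_eq hi hip hp h32 hX hw.symm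
  rw [← LinearMap.comp_apply, ← LinearMap.lTensor_comp, h21.linearMap_comp_eq_zero]
  simp

lemma lTensor_subtype_ker_injective (P : Type*) [AddCommGroup P] [Module R P]
    (h32 : Function.Exact d₃ d₂) (h21 : Function.Exact d₂ d₁)
    (hP : Function.Exact (d₃.lTensor P) (d₂.lTensor P)) :
    Function.Injective ((LinearMap.ker d₁).subtype.lTensor P) := by
  rw [injective_iff_map_eq_zero]
  intro z hz
  set e := d₂.codRestrict (LinearMap.ker d₁) fun x => LinearMap.mem_ker.2 (h21.apply_apply_eq_zero x) with he
  obtain ⟨z, rfl⟩ := LinearMap.lTensor_surjective P (LinearMap.codRestrict_ker_surjective h21) z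
  rw [← LinearMap.comp_apply, ← LinearMap.lTensor_comp, LinearMap.subtype_comp_codRestrict] at hz
  obtain ⟨y, rfl⟩ := (hP z).1 hz
  rw [← LinearMap.comp_apply, ← LinearMap.lTensor_comp]
  have : e ∘ₗ d₃ = 0 := LinearMap.ext fun x => Subtype.ext (h32.apply_apply_eq_zero x)
  rw [← he, this]
  simp

end DimensionShift

/-! ### Syzygies over a ring with maximal ideal `I ⊕ J` -/

section Syzygies

open TensorProduct CategoryTheory

variable {R : Type u} [CommRing R] {I J : Ideal R}

lemma SplitBy.eq_bot {n : ℕ} {K : Submodule R (Fin n → R)} (h : SplitBy I J K)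
    (hI : K ⊓ I.finPow _ = ⊥) (hJ : K ⊓ J.finPow _ = ⊥) : K = ⊥ := by
  rw [SplitBy, hI, hJ, bot_sup_eq] at h
  exact le_bot_iff.1 h

/-- The kernel is nonzero, since a nonzero free module does not split. So one of its two components
survives and forces the opposite component of `Q` to vanish. -/
lemma inf_finPow_eq_bot_of_rTensor_injective [IsLocalRing R] [IsNoetherianRing R]
    (hIJ : I ⊓ J = ⊥) (hI : I ≠ ⊥) (hJ : J ≠ ⊥) {a p n : ℕ} (g : (Fin a → R) →ₗ[R] (Fin p → R))
    (hker : SplitBy I J (LinearMap.ker g)) (hrange : SplitBy I J (LinearMap.range g))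
    (hg : LinearMap.range g ≠ ⊥) {Q : Submodule R (Fin n → R)} (hQ : SplitBy I J Q) (hQ0 : Q ≠ ⊥)
    (h : Function.Injective ((LinearMap.ker g).subtype.rTensor Q)) :
    (LinearMap.ker g ⊓ I.finPow _ = ⊥ ∧ Q ≤ J.finPow _) ∨
      (LinearMap.ker g ⊓ J.finPow _ = ⊥ ∧ Q ≤ I.finPow _) := by
  have hg' : LinearMap.ker g ≠ ⊥ := fun h0 => hg (hrange.range_eq_bot hIJ hI hJ g h0)
  have h1 := inf_finPow_eq_bot_or_of_rTensor_injective hIJ hker hQ h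
  have h2 := inf_finPow_eq_bot_or_of_rTensor_injective (inf_comm I J ▸ hIJ) hker.symm hQ.symm h
  by_cases hKI : LinearMap.ker g ⊓ I.finPow _ = ⊥
  · have hKJ : LinearMap.ker g ⊓ J.finPow _ ≠ ⊥ := fun h0 => hg' (hker.eq_bot hKI h0)
    exact Or.inl ⟨hKI, hQ.le_finPow (h2.resolve_left hKJ)⟩
  · have hQJ := h1.resolve_left hKI
    have hQI : Q ⊓ I.finPow _ ≠ ⊥ := fun h0 => hQ0 (hQ.eq_bot h0 hQJ)
    exact Or.inr ⟨h2.resolve_right hQI, hQ.symm.le_finPow hQJ⟩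

namespace FiniteFreeResolution

variable {M : Type v} [AddCommGroup M] [Module R M] {N : Type w} [AddCommGroup N] [Module R N]
  (H : FiniteFreeResolution R M) (G : FiniteFreeResolution R N)

lemma range_d (n : ℕ) : LinearMap.range (G.d (n + 1)) = LinearMap.ker (G.d n) :=
  (LinearMap.exact_iff.1 (G.exact n)).symm

lemma d_comp_d (n : ℕ) : G.d n ∘ₗ G.d (n + 1) = 0 := (G.exact n).linearMap_comp_eq_zero

/-- Two dimension shifts in the first variable of `Tor`. -/
lemma exact_lTensor_ker_d_zero (n : ℕ)
    (h : Function.Exact ((G.d (n + 3)).lTensor M) ((G.d (n + 2)).lTensor M)) :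
    Function.Exact ((G.d (n + 1)).lTensor (LinearMap.ker (H.d 0)))
      ((G.d n).lTensor (LinearMap.ker (H.d 0))) := by
  have h1 := lTensor_exact_of_lTensor_exact (LinearMap.ker H.ε).subtype_injective
    (LinearMap.exact_subtype_ker_map H.ε) H.surjective (G.d_comp_d _) (G.exact (n + 1)) h
  exact lTensor_exact_of_lTensor_exact (LinearMap.ker (H.d 0)).subtype_injective
    (LinearMap.exact_subtype_codRestrict (H.d 0) _)
    (LinearMap.codRestrict_ker_surjective H.exact_zero) (G.d_comp_d _) (G.exact n) h1

variable {H G}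

lemma IsMinimal.splitBy {m : Ideal R} (hG : G.IsMinimal m) (hIJ : I ⊓ J = ⊥) (hm : I ⊔ J = m)
    (n : ℕ) : SplitBy I J (LinearMap.ker (G.d n)) := by
  subst hm
  exact splitBy_ker hIJ _ (hG.ker_d_le n)

lemma IsMinimal.eq_zero_of_ker_d_inf_eq_bot {m : Ideal R} (hG : G.IsMinimal m) (n : ℕ)
    (h0 : LinearMap.ker (G.d n) ≠ ⊥) (h : LinearMap.ker (G.d (n + 1)) ⊓ I.finPow _ = ⊥) {x : R}
    (hx : x ∈ I) (hxm : ∀ y ∈ m, x * y = 0) : x = 0 := by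
  refine eq_zero_of_smul_eq_zero (G.d (n + 1)) (by rwa [range_d]) h hx fun y hy => ?_
  rw [range_d] at hy
  exact funext fun i => hxm _ (hG.ker_d_le n hy i)

/-- By minimality `d 0` has image in `m Rᵇ`, so it kills `x` times any basis vector; injectivity
then leaves no basis vectors. -/
lemma IsMinimal.free_of_socle {m : Ideal R} (hG : G.IsMinimal m) {x : R} (hx0 : x ≠ 0)
    (hxm : ∀ y ∈ m, x * y = 0) (h : LinearMap.ker (G.d 0) = ⊥) : Module.Free R N := by
  have hε : LinearMap.ker G.ε = ⊥ := by
    rw [LinearMap.exact_iff.1 G.exact_zero, LinearMap.range_eq_bot]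
    refine LinearMap.pi_ext' fun i => LinearMap.ext_ring ?_
    exfalso
    refine hx0 ?_
    have h1 : G.d 0 (x • Pi.single i 1) = 0 := by
      rw [map_smul]
      exact funext fun j => hxm _ (hG.ker_ε_le (G.exact_zero.apply_apply_eq_zero _) j)
    simpa using congrFun (LinearMap.ker_eq_bot.1 h (h1.trans (map_zero _).symm)) i
  exact Module.Free.of_equiv (LinearEquiv.ofBijective G.ε ⟨LinearMap.ker_eq_bot.1 hε, G.surjective⟩)

variable [IsLocalRing R]

lemma IsMinimal.ker_d_zero_eq_bot {m : Ideal R} (hG : G.IsMinimal m) (hIJ : I ⊓ J = ⊥)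
    (hm : I ⊔ J = m) (hI : I ≠ ⊥) (hJ : J ≠ ⊥) (n : ℕ) (h : LinearMap.ker (G.d n) = ⊥) :
    LinearMap.ker (G.d 0) = ⊥ := by
  induction n with
  | zero => exact h
  | succ n ih =>
    refine ih ?_
    rw [← range_d]
    refine SplitBy.range_eq_bot hIJ hI hJ _ h ?_
    rw [range_d]
    exact hG.splitBy hIJ hm n

variable [IsNoetherianRing R]

/-- If `Tor` of the second syzygy `P` of `M` and the syzygy `Q` of `N` vanishes, then one of them is
zero or they are killed by `J` and `I` respectively. -/
lemma IsMinimal.syzygy_alternative {m : Ideal R} (hH : H.IsMinimal m) (hG : G.IsMinimal m)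
    (hIJ : I ⊓ J = ⊥) (hm : I ⊔ J = m) (hI : I ≠ ⊥) (hJ : J ≠ ⊥) (q : ℕ)
    (h : Function.Exact ((G.d (q + 5)).lTensor M) ((G.d (q + 4)).lTensor M)) :
    LinearMap.ker (H.d 0) = ⊥ ∨ LinearMap.ker (G.d q) = ⊥ ∨
      (LinearMap.ker (H.d 0) ≤ I.finPow _ ∧ LinearMap.ker (G.d q) ≤ J.finPow _ ∧
        LinearMap.ker (H.d 1) ⊓ I.finPow _ = ⊥ ∧ LinearMap.ker (G.d (q + 1)) ⊓ J.finPow _ = ⊥) ∨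
      (LinearMap.ker (H.d 0) ≤ J.finPow _ ∧ LinearMap.ker (G.d q) ≤ I.finPow _ ∧
        LinearMap.ker (H.d 1) ⊓ J.finPow _ = ⊥ ∧ LinearMap.ker (G.d (q + 1)) ⊓ I.finPow _ = ⊥) := by
  by_cases hP : LinearMap.ker (H.d 0) = ⊥
  · exact Or.inl hP
  by_cases hQ : LinearMap.ker (G.d q) = ⊥
  · exact Or.inr (Or.inl hQ)
  -- This expresses `Tor₁(P, Q) = 0`: two shifts on the side of `M`, and `q + 2` on the side of `N`.
  have hex := exact_lTensor_ker_d_zero H G (q + 2) h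
  have hK : Function.Injective ((LinearMap.ker (H.d 1)).subtype.rTensor (LinearMap.ker (G.d q))) :=
    rTensor_injective_of_lTensor_exact (LinearMap.ker (H.d 1)).subtype_injective
      (LinearMap.exact_subtype_codRestrict (H.d 1) _)
      (LinearMap.codRestrict_ker_surjective (H.exact 0)) (G.d_comp_d (q + 2))
      (by
        rw [LinearMap.exact_iff, LinearMap.ker_codRestrict, range_d])
      (LinearMap.codRestrict_ker_surjective (G.exact q)) hex
  have hL : Function.Injective
      ((LinearMap.ker (G.d (q + 1))).subtype.rTensor (LinearMap.ker (H.d 0))) :=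
    (LinearMap.lTensor_inj_iff_rTensor_inj _ _).1
      (lTensor_subtype_ker_injective _ (G.exact (q + 2)) (G.exact (q + 1)) hex)
  have sH := hH.splitBy hIJ hm
  have sG := hG.splitBy hIJ hm
  have a1 := inf_finPow_eq_bot_of_rTensor_injective hIJ hI hJ (H.d 1) (sH 1)
    (by rw [range_d]; exact sH 0) (by rwa [range_d]) (sG q) hQ hK
  have a2 := inf_finPow_eq_bot_of_rTensor_injective hIJ hI hJ (G.d (q + 1)) (sG (q + 1))
    (by rw [range_d]; exact sG q) (by rwa [range_d]) (sH 0) hP hL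
  -- Excludes the mixed cases: if `P` lies in `J`, then `I` kills it, which `K_I = 0` forbids.
  have key : ∀ {I J : Ideal R}, I ⊓ J = ⊥ → I ≠ ⊥ → LinearMap.ker (H.d 1) ⊓ I.finPow _ = ⊥ →
      ¬ LinearMap.ker (H.d 0) ≤ J.finPow _ := by
    intro I J hIJ hI hK hPJ
    obtain ⟨x, hx, hx0⟩ := Submodule.exists_mem_ne_zero_of_ne_bot hI
    refine hx0 (eq_zero_of_smul_eq_zero (H.d 1) (by rwa [range_d]) hK hx fun y hy => ?_)
    rw [range_d] at hy
    exact smul_eq_zero_of_mem_finPow hIJ hx (hPJ hy)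
  rcases a1 with ⟨hKI, hQJ⟩ | ⟨hKJ, hQI⟩ <;> rcases a2 with ⟨hLI, hPJ⟩ | ⟨hLJ, hPI⟩
  · exact absurd hPJ (key hIJ hI hKI)
  · exact Or.inr (Or.inr (Or.inl ⟨hPI, hQJ, hKI, hLJ⟩))
  · exact Or.inr (Or.inr (Or.inr ⟨hPJ, hQI, hKJ, hLI⟩))
  · exact absurd hPI (key (inf_comm I J ▸ hIJ) hJ hKJ)

/-- If the socle is nonzero, one vanishing `Tor` suffices. -/
lemma IsMinimal.ker_d_zero_eq_bot_or_of_socle {m : Ideal R} (hH : H.IsMinimal m)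
    (hG : G.IsMinimal m) (hIJ : I ⊓ J = ⊥) (hm : I ⊔ J = m) (hI : I ≠ ⊥) (hJ : J ≠ ⊥) {x : R}
    (hx0 : x ≠ 0) (hx : x ∈ I ∨ x ∈ J) (hxm : ∀ y ∈ m, x * y = 0) (q : ℕ)
    (h : Function.Exact ((G.d (q + 5)).lTensor M) ((G.d (q + 4)).lTensor M)) :
    LinearMap.ker (H.d 0) = ⊥ ∨ LinearMap.ker (G.d 0) = ⊥ := by
  by_cases hP : LinearMap.ker (H.d 0) = ⊥
  · exact Or.inl hP
  refine Or.inr ?_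
  by_cases hQ : LinearMap.ker (G.d q) = ⊥
  · exact hG.ker_d_zero_eq_bot hIJ hm hI hJ q hQ
  exfalso
  rcases hH.syzygy_alternative hG hIJ hm hI hJ q h with h | h | ⟨-, -, hK, hL⟩ | ⟨-, -, hK, hL⟩
  · exact hP h
  · exact hQ h
  · rcases hx with hx | hx
    · exact hx0 (hH.eq_zero_of_ker_d_inf_eq_bot 0 hP hK hx hxm)
    · exact hx0 (hG.eq_zero_of_ker_d_inf_eq_bot q hQ hL hx hxm)
  · rcases hx with hx | hx
    · exact hx0 (hG.eq_zero_of_ker_d_inf_eq_bot q hQ hL hx hxm)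
    · exact hx0 (hH.eq_zero_of_ker_d_inf_eq_bot 0 hP hK hx hxm)

lemma IsMinimal.ker_d_zero_eq_bot_or {m : Ideal R} (hH : H.IsMinimal m)
    (hG : G.IsMinimal m) (hIJ : I ⊓ J = ⊥) (hm : I ⊔ J = m) (hI : I ≠ ⊥) (hJ : J ≠ ⊥) (q : ℕ)
    (h : Function.Exact ((G.d (q + 5)).lTensor M) ((G.d (q + 4)).lTensor M))
    (h' : Function.Exact ((G.d (q + 6)).lTensor M) ((G.d (q + 5)).lTensor M)) :
    LinearMap.ker (H.d 0) = ⊥ ∨ LinearMap.ker (G.d 0) = ⊥ := by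
  by_cases hP : LinearMap.ker (H.d 0) = ⊥
  · exact Or.inl hP
  refine Or.inr ?_
  by_cases hQ : LinearMap.ker (G.d q) = ⊥
  · exact hG.ker_d_zero_eq_bot hIJ hm hI hJ q hQ
  -- The alternatives at `q` and `q + 1` put either `P` inside both `I` and `J`, or `L` inside the
  -- ideal it avoids.
  refine hG.ker_d_zero_eq_bot hIJ hm hI hJ (q + 1) ?_
  by_contra hL
  have hPIJ : ¬ (LinearMap.ker (H.d 0) ≤ I.finPow _ ∧ LinearMap.ker (H.d 0) ≤ J.finPow _) := by
    rintro ⟨h1, h2⟩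
    exact hP (le_bot_iff.1 ((le_inf h1 h2).trans (inf_finPow_eq_bot hIJ _).le))
  have hLle : ∀ {I : Ideal R}, LinearMap.ker (G.d (q + 1)) ⊓ I.finPow _ = ⊥ →
      ¬ LinearMap.ker (G.d (q + 1)) ≤ I.finPow _ :=
    fun h1 h2 => hL (by rwa [inf_eq_left.2 h2] at h1)
  rcases hH.syzygy_alternative hG hIJ hm hI hJ q h with
    h1 | h1 | ⟨hP1, -, -, hL1⟩ | ⟨hP1, -, -, hL1⟩
  · exact hP h1
  · exact hQ h1
  all_goals
    rcases hH.syzygy_alternative hG hIJ hm hI hJ (q + 1) h' with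
      h2 | h2 | ⟨hP2, hL2, -, -⟩ | ⟨hP2, hL2, -, -⟩
  · exact hP h2
  · exact hL h2
  · exact hLle hL1 hL2
  · exact hPIJ ⟨hP1, hP2⟩
  · exact hP h2
  · exact hL h2
  · exact hPIJ ⟨hP2, hP1⟩
  · exact hLle hL1 hL2

end FiniteFreeResolution

lemma FiniteFreeResolution.projectiveDimension_le_one {N : Type u} [AddCommGroup N] [Module R N]
    (G : FiniteFreeResolution R N) (h : LinearMap.ker (G.d 0) = ⊥) :
    projectiveDimension (ModuleCat.of R N) ≤ 1 := by
  have hproj : ∀ n, HasProjectiveDimensionLT (ModuleCat.of R (Fin n → R)) 1 := fun n => by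
    rw [← projective_iff_hasProjectiveDimensionLT_one, ← IsProjective.iff_projective]
    infer_instance
  let S : ShortComplex (ModuleCat.{u} R) := ShortComplex.mk (ModuleCat.ofHom (G.d 0))
    (ModuleCat.ofHom G.ε) (by
      rw [← ModuleCat.ofHom_comp, G.exact_zero.linearMap_comp_eq_zero]; rfl)
  have hS : S.ShortExact :=
    { exact := (ShortComplex.ShortExact.moduleCat_exact_iff_function_exact _).2 G.exact_zero
      mono_f := (ModuleCat.mono_iff_injective _).2 (LinearMap.ker_eq_bot.1 h)
      epi_g := (ModuleCat.epi_iff_surjective _).2 G.surjective }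
  have := hproj (G.b 0)
  refine (projectiveDimension_le_iff _ 1).2 (hS.hasProjectiveDimensionLT_X₃ 1 (hproj _) ?_)
  exact hasProjectiveDimensionLT_of_ge (ModuleCat.of R (Fin (G.b 0) → R)) 1 2 (by lia)

end Syzygies

/-! ### Socle elements, and reduction to the ideals `I` and `J` -/

section FiberProduct

open TensorProduct CategoryTheory

open IsLocalRing

lemma exists_socle_of_localRingDepth_eq_zero {A : Type*} [CommRing A] [IsLocalRing A]
    [IsNoetherianRing A] (hA : ¬ IsField A) (h : localRingDepth A = 0) :
    ∃ x ∈ maximalIdeal A, x ≠ 0 ∧ ∀ y ∈ maximalIdeal A, x * y = 0 := by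
  have hdisj : Disjoint (maximalIdeal A : Set A) (nonZeroDivisors A) := by
    rw [Set.disjoint_left]
    intro y hy hreg
    have hle : (1 : ℕ∞) ≤ localRingDepth A := by
      refine le_sSup ⟨[y], by simpa using hy, ?_, by simp⟩
      rw [IsLocalRing.isRegular_iff_isWeaklyRegular_of_subset_maximalIdeal (by simpa using hy)]
      rw [RingTheory.Sequence.isWeaklyRegular_singleton_iff]
      intro a b hab
      exact (mul_cancel_left_mem_nonZeroDivisors hreg).1 hab
    rw [h] at hle
    simp at hle
  obtain ⟨x, hx, hx0⟩ := SetLike.exists_of_lt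
    (Ideal.bot_lt_annihilator_of_disjoint_nonZeroDivisors hdisj)
  have hxm : ∀ y ∈ maximalIdeal A, x * y = 0 := fun y hy =>
    Submodule.mem_annihilator.1 hx y hy
  refine ⟨x, ?_, hx0, hxm⟩
  rw [mem_maximalIdeal, mem_nonunits_iff]
  intro hu
  refine hA (isField_iff_maximalIdeal_eq.2 (eq_bot_iff.2 fun y hy => ?_))
  exact (hu.mul_right_eq_zero).1 (hxm y hy)

/-- `R` embeds as a module in `S × T`, which is Noetherian over `R` because both maps are
surjective. -/
lemma isNoetherianRing_of_ker_inf_ker_eq_bot {R S T : Type*} [CommRing R] [CommRing S] [CommRing T]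
    [IsNoetherianRing S] [IsNoetherianRing T] (f : R →+* S) (g : R →+* T)
    (hf : Function.Surjective f) (hg : Function.Surjective g)
    (h : ∀ r, f r = 0 → g r = 0 → r = 0) : IsNoetherianRing R := by
  let := f.toAlgebra
  let := g.toAlgebra
  have := RingHomSurjective.mk hf
  have := RingHomSurjective.mk hg
  let iS : S →ₛₗ[f] S := { toFun := id, map_add' := fun _ _ => rfl, map_smul' := fun _ _ => rfl }
  let iT : T →ₛₗ[g] T := { toFun := id, map_add' := fun _ _ => rfl, map_smul' := fun _ _ => rfl }
  have hS : IsNoetherian R S :=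
    (LinearMap.isNoetherian_iff_of_bijective iS Function.bijective_id).2 inferInstance
  have hT : IsNoetherian R T :=
    (LinearMap.isNoetherian_iff_of_bijective iT Function.bijective_id).2 inferInstance
  refine isNoetherian_of_injective ((Algebra.linearMap R S).prod (Algebra.linearMap R T)) ?_
  rw [injective_iff_map_eq_zero]
  intro r hr
  exact h r (congrArg Prod.fst hr) (congrArg Prod.snd hr)

lemma map_ne_zero_iff_isUnit_of_surjective {A k : Type*} [CommRing A] [IsLocalRing A] [Field k]
    {π : A →+* k} (hπ : Function.Surjective π) {a : A} : π a ≠ 0 ↔ IsUnit a := by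
  have : RingHom.ker π = maximalIdeal A :=
    eq_maximalIdeal (RingHom.ker_isMaximal_of_surjective π hπ)
  rw [Ne, ← RingHom.mem_ker, this, mem_maximalIdeal, mem_nonunits_iff, not_not]

/-- The vanishing of `Tor` over a local ring given by two surjections that exhibit it as a fiber
product over the residue field. -/
lemma vanishing_of_surjections {S : Type v} [CommRing S] [IsLocalRing S] [IsNoetherianRing S]
    {T : Type w} [CommRing T] [IsLocalRing T] [IsNoetherianRing T] {R : Type u} [CommRing R]
    [IsLocalRing R] (hS : ¬ IsField S) (hT : ¬ IsField T) (f : R →+* S) (g : R →+* T)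
    (hf : Function.Surjective f) (hg : Function.Surjective g)
    (hfg : ∀ r, f r = 0 → g r = 0 → r = 0)
    (hfS : ∀ s ∈ maximalIdeal S, ∃ r, f r = s ∧ g r = 0)
    (hgT : ∀ t ∈ maximalIdeal T, ∃ r, f r = 0 ∧ g r = t)
    (M N : Type u) [AddCommGroup M] [Module R M] [Module.Finite R M]
    [AddCommGroup N] [Module R N] [Module.Finite R N] :
    ((localRingDepth S = 0 ∨ localRingDepth T = 0) →
      (∃ l : ℕ, 5 ≤ l ∧ TorVanishes (ModuleCat.of R M) (ModuleCat.of R N) l) →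
        Module.Free R M ∨ Module.Free R N) ∧
    ((∃ l : ℕ, 5 ≤ l ∧ TorVanishes (ModuleCat.of R M) (ModuleCat.of R N) l ∧
        TorVanishes (ModuleCat.of R M) (ModuleCat.of R N) (l + 1)) →
      CategoryTheory.projectiveDimension (ModuleCat.of R M) ≤ 1 ∨
        CategoryTheory.projectiveDimension (ModuleCat.of R N) ≤ 1) := by
  have := isNoetherianRing_of_ker_inf_ker_eq_bot f g hf hg hfg
  have hfm : ∀ y ∈ maximalIdeal R, f y ∈ maximalIdeal S := fun y hy => by
    have := hf.isLocalHom f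
    exact map_nonunit f y hy
  have hgm : ∀ y ∈ maximalIdeal R, g y ∈ maximalIdeal T := fun y hy => by
    have := hg.isLocalHom g
    exact map_nonunit g y hy
  have hIJ : RingHom.ker g ⊓ RingHom.ker f = ⊥ :=
    eq_bot_iff.2 fun r hr => hfg r hr.2 hr.1
  have hm : RingHom.ker g ⊔ RingHom.ker f = maximalIdeal R := by
    refine le_antisymm (sup_le (le_maximalIdeal (RingHom.ker_ne_top g))
      (le_maximalIdeal (RingHom.ker_ne_top f))) fun y hy => ?_
    obtain ⟨r, hr, hr0⟩ := hfS _ (hfm y hy)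
    exact Submodule.mem_sup.2 ⟨r, hr0, y - r, by simp [RingHom.mem_ker, hr], by simp⟩
  have hI : RingHom.ker g ≠ ⊥ := fun h0 => by
    refine hS (isField_iff_maximalIdeal_eq.2 (eq_bot_iff.2 fun s hs => ?_))
    obtain ⟨r, rfl, hr⟩ := hfS s hs
    have : r ∈ RingHom.ker g := hr
    rw [h0, Ideal.mem_bot] at this
    simp [this]
  have hJ : RingHom.ker f ≠ ⊥ := fun h0 => by
    refine hT (isField_iff_maximalIdeal_eq.2 (eq_bot_iff.2 fun t ht => ?_))
    obtain ⟨r, hr, rfl⟩ := hgT t ht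
    have : r ∈ RingHom.ker f := hr
    rw [h0, Ideal.mem_bot] at this
    simp [this]
  obtain ⟨H, hH⟩ := exists_minimal_resolution (R := R) M
  obtain ⟨G, hG⟩ := exists_minimal_resolution (R := R) N
  constructor
  · rintro hdepth ⟨l, hl, htor⟩
    -- The bound is `5 = 1 + 2 + 2`: `Tor₁` of two syzygies, each at least the second.
    obtain ⟨q, rfl⟩ := Nat.exists_eq_add_of_le' hl
    obtain ⟨x, hx0, hx, hxm⟩ : ∃ x : R, x ≠ 0 ∧ (x ∈ RingHom.ker g ∨ x ∈ RingHom.ker f) ∧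
        ∀ y ∈ maximalIdeal R, x * y = 0 := by
      rcases hdepth with h | h
      · obtain ⟨s, hs, hs0, hsm⟩ := exists_socle_of_localRingDepth_eq_zero hS h
        obtain ⟨r, rfl, hr⟩ := hfS s hs
        refine ⟨r, fun h0 => hs0 (by simp [h0]), Or.inl hr, fun y hy => hfg _ ?_ ?_⟩
        · rw [map_mul, hsm _ (hfm y hy)]
        · rw [map_mul, hr, zero_mul]
      · obtain ⟨t, ht, ht0, htm⟩ := exists_socle_of_localRingDepth_eq_zero hT h
        obtain ⟨r, hr, rfl⟩ := hgT t ht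
        refine ⟨r, fun h0 => ht0 (by simp [h0]), Or.inr hr, fun y hy => hfg _ ?_ ?_⟩
        · rw [map_mul, hr, zero_mul]
        · rw [map_mul, htm _ (hgm y hy)]
    exact (hH.ker_d_zero_eq_bot_or_of_socle hG hIJ hm hI hJ hx0 hx hxm q
      (G.exact_of_torVanishes M (q + 4) htor)).imp
        (hH.free_of_socle hx0 hxm) (hG.free_of_socle hx0 hxm)
  · rintro ⟨l, hl, htor, htor'⟩
    obtain ⟨q, rfl⟩ := Nat.exists_eq_add_of_le' hl
    exact (hH.ker_d_zero_eq_bot_or hG hIJ hm hI hJ q (G.exact_of_torVanishes M (q + 4) htor)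
      (G.exact_of_torVanishes M (q + 5) htor')).imp
        H.projectiveDimension_le_one G.projectiveDimension_le_one

end FiberProduct

theorem mainTheorem5
    {S : Type v} [CommRing S] [IsLocalRing S] [IsNoetherianRing S]
    {T : Type w} [CommRing T] [IsLocalRing T] [IsNoetherianRing T]
    {k : Type x} [Field k]
    (πS : S →+* k) (hπS : Function.Surjective πS)
    (πT : T →+* k) (hπT : Function.Surjective πT)
    (hS : ¬ IsField S) (hT : ¬ IsField T)
    {R : Type u} [CommRing R] (e : R ≃+* fiberProduct πS πT)
    (M N : Type u) [AddCommGroup M] [Module R M] [Module.Finite R M]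
    [AddCommGroup N] [Module R N] [Module.Finite R N] :
    ((localRingDepth S = 0 ∨ localRingDepth T = 0) →
      (∃ l : ℕ, 5 ≤ l ∧ TorVanishes (ModuleCat.of R M) (ModuleCat.of R N) l) →
        Module.Free R M ∨ Module.Free R N) ∧
    ((∃ l : ℕ, 5 ≤ l ∧ TorVanishes (ModuleCat.of R M) (ModuleCat.of R N) l ∧
        TorVanishes (ModuleCat.of R M) (ModuleCat.of R N) (l + 1)) →
      CategoryTheory.projectiveDimension (ModuleCat.of R M) ≤ 1 ∨
        CategoryTheory.projectiveDimension (ModuleCat.of R N) ≤ 1) := by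
  have hmem : ∀ {s : S} {t : T}, πS s = πT t → (s, t) ∈ fiberProduct πS πT := fun h => h
  let f : R →+* S := (RingHom.fst S T).comp ((fiberProduct πS πT).subtype.comp e.toRingHom)
  let g : R →+* T := (RingHom.snd S T).comp ((fiberProduct πS πT).subtype.comp e.toRingHom)
  have hlift : ∀ s t, πS s = πT t → ∃ r, f r = s ∧ g r = t := fun s t h =>
    ⟨e.symm ⟨(s, t), hmem h⟩, by simp [f], by simp [g]⟩
  have hcomp : ∀ r, πS (f r) = πT (g r) := fun r => (e r).2
  have hf : Function.Surjective f := fun s => by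
    obtain ⟨t, ht⟩ := hπT (πS s)
    obtain ⟨r, hr, -⟩ := hlift s t ht.symm
    exact ⟨r, hr⟩
  have hg : Function.Surjective g := fun t => by
    obtain ⟨s, hs⟩ := hπS (πT t)
    obtain ⟨r, -, hr⟩ := hlift s t hs
    exact ⟨r, hr⟩
  have hfg : ∀ r r', f r = f r' → g r = g r' → r = r' := fun r r' h1 h2 =>
    e.injective (Subtype.ext (Prod.ext h1 h2))
  have hS0 : ∀ s ∈ IsLocalRing.maximalIdeal S, πS s = 0 := fun s hs => by
    by_contra h
    exact hs ((map_ne_zero_iff_isUnit_of_surjective hπS).1 h)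
  have hT0 : ∀ t ∈ IsLocalRing.maximalIdeal T, πT t = 0 := fun t ht => by
    by_contra h
    exact ht ((map_ne_zero_iff_isUnit_of_surjective hπT).1 h)
  -- Units of `S` and `T` are detected in `k`, and the inverses of the two components agree there,
  -- so they glue to an inverse in `R`.
  have hloc : IsLocalHom f := ⟨fun r hr => by
    have hr' : IsUnit (g r) := (map_ne_zero_iff_isUnit_of_surjective hπT).1
      (hcomp r ▸ (map_ne_zero_iff_isUnit_of_surjective hπS).2 hr)
    obtain ⟨s, hs⟩ := hr.exists_right_inv
    obtain ⟨t, ht⟩ := hr'.exists_right_inv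
    have hst : πS s = πT t := by
      have h1 : πS (f r) * πS s = 1 := by rw [← map_mul, hs, map_one]
      have h2 : πS (f r) * πT t = 1 := by rw [hcomp, ← map_mul, ht, map_one]
      exact mul_left_cancel₀ (left_ne_zero_of_mul_eq_one h1) (h1.trans h2.symm)
    obtain ⟨r', rfl, rfl⟩ := hlift s t hst
    exact IsUnit.of_mul_eq_one r' (hfg _ _ (by rw [map_mul, hs, map_one])
      (by rw [map_mul, ht, map_one]))⟩
  have : IsLocalRing R := RingHom.domain_isLocalRing f
  exact vanishing_of_surjections hS hT f g hf hg
    (fun r h1 h2 => hfg r 0 (h1.trans (map_zero f).symm) (h2.trans (map_zero g).symm))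
    (fun s hs => hlift s 0 (by rw [hS0 s hs, map_zero]))
    (fun t ht => hlift 0 t (by rw [hT0 t ht, map_zero])) M N
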